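/- Let $(X_n)_{n\ge1}$ be i.i.d. random variables with values in $\mathbb{Z}_+=\{0,1,2,\dots\}$ and infinite support (that is, $P(X_1=i)>0$ for infinitely many $i$). Put $$h_{\ell\mid j}:=\frac{P(X_1=\ell)}{P(X_1\ge j)}\ (\ell\ge j\ge 0),\qquad h_j:=h_{j\mid j},\qquad d_{j,k}:=1-\sum_{i=1}^k h_{j+i\mid j}.$$ *Sample.* Let $M_n=\max(X_1,\dots,X_n)$, let $L_1=1$ and $L_{i+1}=\min\{m>L_i: X_m>X_{L_i}\}$ be the record times, and let $R_i=X_{L_i}$ be the records. Fix $k\in\mathbb{N}=\{1,2,\dots\}$. The near-records associated with $R_i$ are the observations $X_m$ with $L_i<m<L_{i+1}$ and $M_{m-1}-(k+1)<X_m\le M_{m-1}$; their number is $S_i$ and their values, in order of appearance, are $Y_i^1,\dots,Y_i^{S_i}$. From the sample of the first $n\ge 1$ records and their associated near-records, form, for $m\in\mathbb{Z}_+$ and $0\le\ell\le k$, $$A_m^0=\sum_{i=1}^n\Big(\mathbf 1_{\{R_i=m\}}+\sum_{p=1}^{S_i}\mathbf 1_{\{R_i=m,\;Y_i^p=m\}}\Big),\qquad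 A_m^\ell=\sum_{i=1}^n\sum_{p=1}^{S_i}\mathbf 1_{\{R_i=m+\ell,\;Y_i^p=m\}}\ (\ell\ge1),$$ $$V_m^\ell=\sum_{p=0}^{\ell}A_m^p,\qquad N_m^\ell=1+\sum_{p=0}^{\ell}V_{m+p}^{\ell-p},\qquad \hat h_{j,k}:=\frac{V_j^k}{N_j^k}.$$ This $\hat h_{j,k}$ is the $\delta$-record-based nonparametric estimator (NPMLE) of $h_j$, with $k=-\delta-1$. Let $\tilde h_{j,k}$ be given by the same formula with $A_m^\ell$ replaced by the counts over the entire sequence, $$\tilde A_m^0=\mathbf 1_{\{X_1=m\}}+\sum_{i\ge2}\mathbf 1_{\{X_i=m,\;M_{i-1}\le m\}},\qquad \tilde A_m^\ell=\sum_{i\ge2}\mathbf 1_{\{X_i=m,\;M_{i-1}=m+\ell\}}\ (\ell\ge1).$$ **Theorem.** Let $k\in\mathbb{N}$ and $j\in\mathbb{Z}_+$. For every $n\ge1$, almost surely on the event $\{R_n\ge j+k\}$, the estimator $\hat h_{j,k}$ computed from the first $n$ records and their near-records equals $\tilde h_{j,k}$. Moreover, the following holds for $\tilde h_{j,k}$,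 and also for $\hat h_{j,k}$ computed from the first $n$ records and their near-records, where $n\ge1$ may be deterministic or random, whenever $R_n\ge j+k$ almost surely. Write $\hat h_{j,k}$ for either of the two. 1. $\hat h_{j,k}$ takes values in $\mathbb{Q}\cap[0,1)$. 2. For all $a,b\in\mathbb{Z}_+$ with $a<b$ and $\gcd(a,b)=1$, and $q=a/b$, $$P(\hat h_{j,k}=q)=(d_{j,k}-h_j)\sum_{i=1}^\infty\binom{bi-1}{ai}h_j^{ai}(1-d_{j,k})^{(b-a)i-1},$$ where the series converges (and $0^0=1$). 3. For all $x\in[0,1)$, the cumulative distribution function $G_{j,k}$ of $\hat h_{j,k}$ satisfies $$G_{j,k}(x)=P(\hat h_{j,k}\le x)=(d_{j,k}-h_j)\sum_{m=0}^\infty(1-d_{j,k})^m\sum_{\ell=0}^{\left\lfloor\frac{(1+m)x}{1-x}\right\rfloor}\binom{m+\ell}{\ell}h_j^\ell,$$ where the series over $m$ converges. -/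

import Mathlib

open MeasureTheory ProbabilityTheory
open scoped ENNReal

noncomputable section

namespace DeltaRecord

/-! Paths `x : ℕ → ℕ` are indexed from `0`: `x i` is the observation `X_{i+1}`. -/

/-! ### Hazard rates of a random variable `Y` with values in the nonnegative integers -/

/-- The conditional hazard rate `h_{l|j} = P(Y = l) / P(Y ≥ j)`. -/
def condHazard {Ω : Type*} [MeasurableSpace Ω] (μ : Measure Ω) (Y : Ω → ℕ) (l j : ℕ) : ℝ :=
  μ.real {ω | Y ω = l} / μ.real {ω | j ≤ Y ω}

/-- The hazard rate `h_j = P(Y = j | Y ≥ j)`. -/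
def hazard {Ω : Type*} [MeasurableSpace Ω] (μ : Measure Ω) (Y : Ω → ℕ) (j : ℕ) : ℝ :=
  condHazard μ Y j j

/-- `d_{j,k} = 1 - ∑_{i=1}^k h_{j+i|j}`. -/
def dParam {Ω : Type*} [MeasurableSpace Ω] (μ : Measure Ω) (Y : Ω → ℕ) (j k : ℕ) : ℝ :=
  1 - ∑ i ∈ Finset.Icc 1 k, condHazard μ Y (j + i) j

/-! ### Records and near-records of a path -/

/-- The running maximum of `x 0, …, x i`. -/
def partialMax (x : ℕ → ℕ) (i : ℕ) : ℕ := (Finset.range (i + 1)).sup x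

/-- Record times: the first observation is a record, and each next record time is the first later
time at which the current record value is strictly exceeded. `recordTime x i` is the time of the
`(i+1)`-st record. (If there is no further record the infimum is the junk value `0`.) -/
def recordTime (x : ℕ → ℕ) : ℕ → ℕ
  | 0 => 0
  | i + 1 => sInf {m | recordTime x i < m ∧ x (recordTime x i) < x m}

/-- The value of the `(i+1)`-st record. So the `n`-th record `R_n` is `recordValue x (n - 1)`. -/
def recordValue (x : ℕ → ℕ) (i : ℕ) : ℕ := x (recordTime x i)

/-- The times of the near-records with parameter `k + 1` associated with the `(i+1)`-st record:
times `m` strictly between the two consecutive record times at which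
`M - (k + 1) < x m ≤ M`, with `M` the maximum of the observations before time `m`. -/
def nearRecordTimes (x : ℕ → ℕ) (k i : ℕ) : Finset ℕ :=
  (Finset.Ioo (recordTime x i) (recordTime x (i + 1))).filter fun m =>
    partialMax x (m - 1) < x m + (k + 1) ∧ x m ≤ partialMax x (m - 1)

/-! ### The sample `(R, S, Y)` and the estimator computed from it -/

/-- Data `(r, s, y)`: `n` record values, the numbers of near-records associated with each of them,
and the values of these near-records. -/
structure Sample (n : ℕ) where
  r : Fin n → ℕ
  s : Fin n → ℕ
  y : (i : Fin n) → Fin (s i) → ℕ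

/-- The sample of the first `n` records of the path `x` and their associated near-records
(with parameter `k + 1`), listed in order of appearance. -/
def sampleOf (x : ℕ → ℕ) (k n : ℕ) : Sample n where
  r i := recordValue x i
  s i := (nearRecordTimes x k i).card
  y i p := x ((nearRecordTimes x k i).orderEmbOfFin rfl p)

namespace Sample

/-- `a_m^l` computed from a sample. -/
def a {n : ℕ} (t : Sample n) (m l : ℕ) : ℕ :=
  if l = 0 then
    ∑ i : Fin n, ((if t.r i = m then 1 else 0) +
      ∑ p : Fin (t.s i), if t.r i = m ∧ t.y i p = m then 1 else 0)
  else
    ∑ i : Fin n, ∑ p : Fin (t.s i), if t.r i = m + l ∧ t.y i p = m then 1 else 0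

/-- `v_m^l = ∑_{p=0}^l a_m^p`. -/
def v {n : ℕ} (t : Sample n) (m l : ℕ) : ℕ := ∑ p ∈ Finset.range (l + 1), t.a m p

/-- `n_m^l = 1 + ∑_{p=0}^l v_{m+p}^{l-p}`. -/
def num {n : ℕ} (t : Sample n) (m l : ℕ) : ℕ :=
  1 + ∑ p ∈ Finset.range (l + 1), t.v (m + p) (l - p)

/-- The estimator `v_j^k / n_j^k` of the hazard rate at `j`. -/
def estimator {n : ℕ} (t : Sample n) (j k : ℕ) : ℝ := (t.v j k : ℝ) / (t.num j k : ℝ)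

end Sample

/-! ### The uncensored counts, computed from the entire path -/

/-- The number of times in the entire path that `m` is a weak record (`l = 0`), or that `m` is
observed when the previous maximum is `m + l` (`l ≥ 1`). -/
def fullA (x : ℕ → ℕ) (m l : ℕ) : ℝ≥0∞ :=
  if l = 0 then
    (if x 0 = m then 1 else 0) + ∑' i : ℕ, if x (i + 1) = m ∧ partialMax x i ≤ m then 1 else 0
  else
    ∑' i : ℕ, if x (i + 1) = m ∧ partialMax x i = m + l then 1 else 0

def fullV (x : ℕ → ℕ) (m l : ℕ) : ℝ≥0∞ := ∑ p ∈ Finset.range (l + 1), fullA x m p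

def fullNum (x : ℕ → ℕ) (m l : ℕ) : ℝ≥0∞ :=
  1 + ∑ p ∈ Finset.range (l + 1), fullV x (m + p) (l - p)

/-- The estimator with the counts taken over the entire path. -/
def fullEstimator (x : ℕ → ℕ) (j k : ℕ) : ℝ := (fullV x j k / fullNum x j k).toReal

end DeltaRecord

end

namespace DeltaRecord

/-! ### Record times of unbounded paths -/

/-! Almost every path is unbounded (`ae_exists_lt`), so there is a first time `T` at which it
exceeds `j + k`. Summing `A_m^p` over `p ≤ l` counts the times at which `m` is observed while all
earlier values are at most `m + l` (`sum_hit_eq`). All the quantities `V_{j+p}^{k-p}` share the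
threshold `j + k`, so they count the visits to `j + p` before `T`. With `l` visits to `j` and `m`
visits to `(j, j + k]` before `T`, the estimator is therefore `l / (1 + l + m)`
(`ExitCounts.fullEstimator_eq`).

The sample loses nothing: between records the previous maximum is the current record, so every
contributing observation with `l ≤ k` is a record or a near-record, and once `R_n ≥ j + k` nothing
contributes from the next record on (`sample_estimator_eq_fullEstimator`).

Ignoring observations below `j`, each observation equals `j` with probability `h`, lies in `(j, j +
k]` with probability `1 - d`, and exceeds `j + k` with probability `d - h`. Hence `(l, m)` has
probability `C(m + l, l) h^l (1 - d)^m (d - h)` (`measureReal_exitCounts`). Both formulas sum this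
law over the pairs satisfying `l / (1 + l + m) = a / b`, respectively `≤ x`. -/

theorem partialMax_le_iff {x : ℕ → ℕ} {i c : ℕ} : partialMax x i ≤ c ↔ ∀ s ≤ i, x s ≤ c := by
  simp [partialMax, Finset.sup_le_iff]

theorem le_partialMax (x : ℕ → ℕ) {s i : ℕ} (h : s ≤ i) : x s ≤ partialMax x i :=
  partialMax_le_iff.1 le_rfl s h

section Unbounded

variable {x : ℕ → ℕ} (hx : ∀ c, ∃ t, c < x t)
include hx

/-- Unboundedness makes the set defining the next record time nonempty, so its infimum is attained
and is not the junk value. The bound `hmax` is a hypothesis because it is proved by an induction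
that uses this lemma. -/
theorem recordTime_succ_mem_aux (i : ℕ) (hmax : ∀ s ≤ recordTime x i, x s ≤ recordValue x i) :
    recordTime x i < recordTime x (i + 1) ∧ recordValue x i < recordValue x (i + 1) := by
  have hne : {m | recordTime x i < m ∧ x (recordTime x i) < x m}.Nonempty := by
    obtain ⟨t, ht⟩ := hx (recordValue x i)
    refine ⟨t, ?_, ht⟩
    by_contra hle
    exact absurd (hmax t (not_lt.1 hle)) (not_le.2 ht)
  exact Nat.sInf_mem hne

theorem le_recordValue_of_le (i : ℕ) : ∀ s ≤ recordTime x i, x s ≤ recordValue x i := by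
  induction i with
  | zero =>
    intro s hs
    have : s = 0 := Nat.le_zero.1 hs
    subst this
    exact le_rfl
  | succ i ih =>
    intro s hs
    obtain ⟨h1, h2⟩ := recordTime_succ_mem_aux hx i ih
    rcases hs.lt_or_eq with hlt | heq
    · by_contra hgt
      have hnot : s ∉ {m | recordTime x i < m ∧ x (recordTime x i) < x m} :=
        Nat.notMem_of_lt_sInf hlt
      apply hnot
      have hgt' : recordValue x i < x s := h2.trans (not_le.1 hgt)
      refine ⟨?_, hgt'⟩
      by_contra hle
      exact absurd (ih s (not_lt.1 hle)) (not_le.2 hgt')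
    · rw [heq]
      exact le_rfl

theorem recordTime_lt_succ (i : ℕ) : recordTime x i < recordTime x (i + 1) :=
  (recordTime_succ_mem_aux hx i (le_recordValue_of_le hx i)).1

theorem recordValue_lt_succ (i : ℕ) : recordValue x i < recordValue x (i + 1) :=
  (recordTime_succ_mem_aux hx i (le_recordValue_of_le hx i)).2

theorem le_recordValue_of_lt_succ (i : ℕ) {s : ℕ} (hs : s < recordTime x (i + 1)) :
    x s ≤ recordValue x i := by
  by_contra hgt
  have hnot : s ∉ {m | recordTime x i < m ∧ x (recordTime x i) < x m} :=
    Nat.notMem_of_lt_sInf hs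
  apply hnot
  refine ⟨?_, not_le.1 hgt⟩
  by_contra hle
  exact hgt (le_recordValue_of_le hx i s (not_lt.1 hle))

theorem partialMax_eq_recordValue (i : ℕ) {s : ℕ} (h1 : recordTime x i ≤ s)
    (h2 : s < recordTime x (i + 1)) : partialMax x s = recordValue x i :=
  le_antisymm
    (partialMax_le_iff.2 fun _ hs => le_recordValue_of_lt_succ hx i (hs.trans_lt h2))
    (le_partialMax x h1)

end Unbounded

/-! ### The counts as sums over times -/

/-- The indicator that the observation at time `t` contributes to the count `fullA x m l`. -/
def hit (x : ℕ → ℕ) (m l : ℕ) : ℕ → ℕ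
  | 0 => if l = 0 ∧ x 0 = m then 1 else 0
  | t + 1 =>
    if l = 0 then (if x (t + 1) = m ∧ partialMax x t ≤ m then 1 else 0)
    else (if x (t + 1) = m ∧ partialMax x t = m + l then 1 else 0)

theorem fullA_eq_tsum_hit (x : ℕ → ℕ) (m l : ℕ) : fullA x m l = ∑' t, (hit x m l t : ℝ≥0∞) := by
  rw [(tsum_eq_zero_add' ENNReal.summable : ∑' t, (hit x m l t : ℝ≥0∞) = _)]
  unfold fullA
  by_cases hl : l = 0 <;> simp [hit, hl]

theorem sum_near_eq (x : ℕ → ℕ) (k i : ℕ) (g : ℕ → ℕ) :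
    ∑ p : Fin (nearRecordTimes x k i).card, g ((nearRecordTimes x k i).orderEmbOfFin rfl p) =
      ∑ t ∈ nearRecordTimes x k i, g t := by
  rw [← Finset.sum_coe_sort (nearRecordTimes x k i) g]
  exact Fintype.sum_equiv ((nearRecordTimes x k i).orderIsoOfFin rfl).toEquiv _ _ fun p => rfl

theorem sum_recordTime_eq {x : ℕ → ℕ} (hx : ∀ c, ∃ t, c < x t) (g : ℕ → ℕ) (n : ℕ) :
    ∑ t ∈ Finset.range (recordTime x n), g t =
      ∑ i ∈ Finset.range n, (g (recordTime x i) +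
        ∑ t ∈ Finset.Ioo (recordTime x i) (recordTime x (i + 1)), g t) := by
  induction n with
  | zero => simp [recordTime]
  | succ n ih =>
    rw [Finset.sum_range_succ, ← ih, Finset.range_eq_Ico, Finset.range_eq_Ico,
      ← Finset.sum_Ico_consecutive g (Nat.zero_le _) (recordTime_lt_succ hx n).le,
      ← Finset.Ioo_insert_left (recordTime_lt_succ hx n), Finset.sum_insert (by simp)]

/-- At a record after the first, the previous maximum is strictly smaller than the new value, which
rules out every `l ≥ 1`. -/
theorem hit_recordTime {x : ℕ → ℕ} (hx : ∀ c, ∃ t, c < x t) (m l i : ℕ) :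
    hit x m l (recordTime x i) = if l = 0 ∧ recordValue x i = m then 1 else 0 := by
  cases i with
  | zero => rfl
  | succ i =>
    have h1 := recordTime_lt_succ hx i
    obtain ⟨t, ht⟩ := Nat.exists_eq_add_of_lt h1
    have hM : partialMax x (recordTime x i + t) = recordValue x i :=
      partialMax_eq_recordValue hx i (by omega) (by omega)
    have h2 := recordValue_lt_succ hx i
    have h3 : recordValue x (i + 1) = x (recordTime x i + t + 1) := by rw [← ht]; rfl
    rw [ht]
    simp only [hit, hM, ← h3]
    split_ifs <;> first | rfl | omega

/-- Between records the previous maximum is the current record, which bounds `x t`. For `l = 0` the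
condition `partialMax ≤ m` thus becomes an equality, and the two cases of `hit` merge. -/
theorem hit_of_mem_Ioo {x : ℕ → ℕ} (hx : ∀ c, ∃ t, c < x t) (m l i : ℕ) {t : ℕ}
    (h1 : recordTime x i < t) (h2 : t < recordTime x (i + 1)) :
    hit x m l t = if recordValue x i = m + l ∧ x t = m then 1 else 0 := by
  obtain ⟨s, rfl⟩ := Nat.exists_eq_add_one_of_ne_zero (show t ≠ 0 by omega)
  have hM : partialMax x s = recordValue x i :=
    partialMax_eq_recordValue hx i (by omega) (by omega)
  have h3 : x (s + 1) ≤ recordValue x i := le_recordValue_of_lt_succ hx i h2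
  simp only [hit, hM]
  split_ifs <;> first | rfl | omega

theorem hit_eq_zero_of_recordTime_le {x : ℕ → ℕ} (hx : ∀ c, ∃ t, c < x t) {m l n t : ℕ}
    (hn : m + l < recordValue x n) (ht : recordTime x n ≤ t) : hit x m l t = 0 := by
  rcases ht.eq_or_lt with rfl | ht
  · rw [hit_recordTime hx, if_neg]
    omega
  · obtain ⟨s, rfl⟩ := Nat.exists_eq_add_one_of_ne_zero (show t ≠ 0 by omega)
    have hM : recordValue x n ≤ partialMax x s := le_partialMax x (by omega)
    simp only [hit]
    split_ifs <;> first | rfl | omega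

theorem sample_a_eq_sum_hit {x : ℕ → ℕ} (hx : ∀ c, ∃ t, c < x t) {k m l : ℕ} (hl : l ≤ k)
    (n : ℕ) :
    (sampleOf x k n).a m l = ∑ t ∈ Finset.range (recordTime x n), hit x m l t := by
  rw [sum_recordTime_eq hx]
  have hnear (i : ℕ) :
      ∑ p : Fin (nearRecordTimes x k i).card, (if recordValue x i = m + l ∧
          x ((nearRecordTimes x k i).orderEmbOfFin rfl p) = m then 1 else 0) =
        ∑ t ∈ Finset.Ioo (recordTime x i) (recordTime x (i + 1)), hit x m l t := by
    rw [sum_near_eq x k i fun t => if recordValue x i = m + l ∧ x t = m then 1 else 0,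
      nearRecordTimes, Finset.sum_filter]
    refine Finset.sum_congr rfl fun t ht => ?_
    obtain ⟨h1, h2⟩ := Finset.mem_Ioo.1 ht
    rw [hit_of_mem_Ioo hx m l i h1 h2, partialMax_eq_recordValue hx i (by omega) (by omega)]
    -- The near-record filter removes nothing: a contributing `x t` lies `l ≤ k` below the current
    -- record.
    split_ifs <;> first | rfl | omega
  simp only [← hnear, hit_recordTime hx, Finset.sum_range]
  unfold Sample.a
  by_cases h0 : l = 0
  · subst h0
    simp only [sampleOf, if_true, add_zero, true_and]
    rfl
  · simp only [sampleOf, h0, if_false, false_and, zero_add]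
    rfl

theorem sample_a_eq_fullA {x : ℕ → ℕ} (hx : ∀ c, ∃ t, c < x t) {k m l n : ℕ} (hl : l ≤ k)
    (hn : m + l < recordValue x n) : ((sampleOf x k n).a m l : ℝ≥0∞) = fullA x m l := by
  rw [fullA_eq_tsum_hit, sample_a_eq_sum_hit hx hl, Nat.cast_sum]
  refine (tsum_eq_sum fun t ht => ?_).symm
  rw [hit_eq_zero_of_recordTime_le hx hn (by simpa using ht), Nat.cast_zero]

theorem sample_estimator_eq_fullEstimator {x : ℕ → ℕ} (hx : ∀ c, ∃ t, c < x t) {j k n : ℕ}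
    (hn : 1 ≤ n) (hR : j + k ≤ recordValue x (n - 1)) :
    (sampleOf x k n).estimator j k = fullEstimator x j k := by
  -- `recordValue x n` is the record of rank `n + 1`, which is strictly above `R_n`.
  have hR' : j + k < recordValue x n := by
    have := recordValue_lt_succ hx (n - 1)
    rw [Nat.sub_add_cancel hn] at this
    omega
  have hv (m l : ℕ) (hl : l ≤ k) (hml : m + l ≤ j + k) :
      ((sampleOf x k n).v m l : ℝ≥0∞) = fullV x m l := by
    rw [Sample.v, fullV, Nat.cast_sum]
    refine Finset.sum_congr rfl fun p hp => ?_
    have hp := Finset.mem_range.1 hp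
    exact sample_a_eq_fullA hx (by omega) (by omega)
  have hnum : ((sampleOf x k n).num j k : ℝ≥0∞) = fullNum x j k := by
    rw [Sample.num, fullNum, Nat.cast_add, Nat.cast_one, Nat.cast_sum]
    congr 1
    refine Finset.sum_congr rfl fun p hp => ?_
    have hp := Finset.mem_range.1 hp
    exact hv _ _ (by omega) (by omega)
  rw [fullEstimator, ← hv j k le_rfl le_rfl, ← hnum, ENNReal.toReal_div, ENNReal.toReal_natCast,
    ENNReal.toReal_natCast, Sample.estimator]

/-! ### The range of the estimators -/

theorem exists_rat_div_eq {v n : ℕ} (h : v < n) :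
    ∃ q : ℚ, 0 ≤ q ∧ q < 1 ∧ (v : ℝ) / (n : ℝ) = (q : ℝ) := by
  refine ⟨(v : ℚ) / n, by positivity, ?_, by push_cast; rfl⟩
  rw [div_lt_one (by exact_mod_cast (Nat.zero_le v).trans_lt h)]
  exact_mod_cast h

theorem Sample.v_lt_num {n : ℕ} (s : Sample n) (j k : ℕ) : s.v j k < s.num j k := by
  unfold Sample.num
  -- The term `p = 0` of the sum is `v j k` itself.
  rw [Finset.sum_range_succ']
  simp only [add_zero, Nat.sub_zero]
  omega

theorem Sample.exists_rat_estimator {n : ℕ} (s : Sample n) (j k : ℕ) :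
    ∃ q : ℚ, 0 ≤ q ∧ q < 1 ∧ s.estimator j k = (q : ℝ) :=
  exists_rat_div_eq (s.v_lt_num j k)

/-- A convergent sum of natural numbers has only finitely many nonzero terms. -/
theorem fullA_mem_range (x : ℕ → ℕ) (m l : ℕ) (h : fullA x m l ≠ ∞) :
    ∃ c : ℕ, fullA x m l = c := by
  rw [fullA_eq_tsum_hit] at h ⊢
  have hfin : (Function.support (hit x m l)).Finite := by
    refine (ENNReal.finite_const_le_of_tsum_ne_top h one_ne_zero).subset fun t ht => ?_
    simpa [Nat.one_le_iff_ne_zero] using ht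
  refine ⟨∑ t ∈ hfin.toFinset, hit x m l t, ?_⟩
  rw [Nat.cast_sum]
  refine tsum_eq_sum fun t ht => ?_
  simpa using ht

theorem exists_nat_sum_eq {ι : Type*} {s : Finset ι} {f : ι → ℝ≥0∞}
    (hf : ∀ i ∈ s, f i ≠ ∞ → ∃ c : ℕ, f i = c) (h : ∑ i ∈ s, f i ≠ ∞) :
    ∃ c : ℕ, ∑ i ∈ s, f i = c := by
  have h' : ∀ i : s, ∃ c : ℕ, f i = c := fun i =>
    hf i i.2 (ENNReal.sum_ne_top.1 h i i.2)
  choose c hc using h'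
  refine ⟨∑ i, c i, ?_⟩
  rw [← Finset.sum_coe_sort, Nat.cast_sum]
  exact Finset.sum_congr rfl fun i _ => hc i

theorem fullV_mem_range (x : ℕ → ℕ) (m l : ℕ) (h : fullV x m l ≠ ∞) :
    ∃ c : ℕ, fullV x m l = c :=
  exists_nat_sum_eq (fun p _ => fullA_mem_range x m p) h

theorem exists_rat_fullEstimator (x : ℕ → ℕ) (j k : ℕ) :
    ∃ q : ℚ, 0 ≤ q ∧ q < 1 ∧ fullEstimator x j k = (q : ℝ) := by
  unfold fullEstimator
  by_cases hN : fullNum x j k = ∞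
  -- Division by `∞` gives `0`, so rationality holds on every path, even one with infinite counts.
  · exact ⟨0, le_rfl, one_pos, by simp [hN]⟩
  · have hsum : ∑ p ∈ Finset.range (k + 1), fullV x (j + p) (k - p) ≠ ∞ := fun h => by
      simp [fullNum, h] at hN
    obtain ⟨N, hN'⟩ := exists_nat_sum_eq (fun p _ => fullV_mem_range x (j + p) (k - p)) hsum
    have hle : fullV x j k ≤ N := by
      rw [← hN']
      exact Finset.single_le_sum (f := fun p => fullV x (j + p) (k - p))
        (fun _ _ => zero_le) (Finset.mem_range.2 (Nat.succ_pos k))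
    obtain ⟨v, hv⟩ := fullV_mem_range x j k (ne_top_of_le_ne_top (ENNReal.natCast_ne_top N) hle)
    have hvN : v < 1 + N := by
      rw [hv] at hle
      have : v ≤ N := by exact_mod_cast hle
      omega
    obtain ⟨q, h0, h1, hq⟩ := exists_rat_div_eq hvN
    refine ⟨q, h0, h1, ?_⟩
    rw [fullNum, hN', hv, ← hq, ENNReal.toReal_div, ENNReal.toReal_natCast,
      ENNReal.toReal_add (by simp) (by simp)]
    simp

/-! ### The full counts of a path that exceeds `j + k` -/

/-- The previous maximum is at most `m + l` exactly when it is at most `m` or equal to `m + p` for a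
unique `p` in `1, …, l`. -/
theorem sum_hit_eq (x : ℕ → ℕ) (m l t : ℕ) :
    ∑ p ∈ Finset.range (l + 1), hit x m p t =
      if x t = m ∧ ∀ s < t, x s ≤ m + l then 1 else 0 := by
  cases t with
  | zero => simp [hit, ite_and]
  | succ t =>
    have hM : (∀ s < t + 1, x s ≤ m + l) ↔ partialMax x t ≤ m + l := by
      simp [partialMax_le_iff]
    simp only [hM]
    induction l with
    | zero => simp [hit]
    | succ l ih =>
      rw [Finset.sum_range_succ, ih (by simp [partialMax_le_iff])]
      simp only [hit]
      split_ifs <;> first | rfl | contradiction | omega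

theorem fullV_eq_tsum (x : ℕ → ℕ) (m l : ℕ) :
    fullV x m l = ∑' t, ((if x t = m ∧ ∀ s < t, x s ≤ m + l then 1 else 0 : ℕ) : ℝ≥0∞) := by
  simp only [fullV, fullA_eq_tsum_hit, ← sum_hit_eq, Nat.cast_sum]
  exact (Summable.tsum_finsetSum fun _ _ => ENNReal.summable).symm

/-- The path `x` takes values at most `j + k` until it first exceeds `j + k`, and before that time
it takes the value `j` exactly `l` times, and values in `(j, j + k]` exactly `m` times. -/
def ExitCounts (x : ℕ → ℕ) (j k l m : ℕ) : Prop :=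
  ∃ t, j + k < x t ∧ (∀ s < t, x s ≤ j + k) ∧ Nat.count (fun s => x s = j) t = l ∧
    Nat.count (fun s => j < x s ∧ x s ≤ j + k) t = m

theorem exists_exitCounts {x : ℕ → ℕ} (hx : ∀ c, ∃ t, c < x t) (j k : ℕ) :
    ∃ l m, ExitCounts x j k l m := by
  classical
  exact ⟨_, _, Nat.find (hx (j + k)), Nat.find_spec (hx (j + k)),
    fun s hs => not_lt.1 (Nat.find_min (hx (j + k)) hs), rfl, rfl⟩

theorem eq_of_first_exceed {x : ℕ → ℕ} {c t t' : ℕ} (h : c < x t) (h1 : ∀ s < t, x s ≤ c)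
    (h' : c < x t') (h1' : ∀ s < t', x s ≤ c) : t = t' := by
  rcases lt_trichotomy t t' with hlt | heq | hlt
  · exact absurd (h1' t hlt) (not_le.2 h)
  · exact heq
  · exact absurd (h1 t' hlt) (not_le.2 h')

theorem ExitCounts.unique {x : ℕ → ℕ} {j k l m l' m' : ℕ} (h : ExitCounts x j k l m)
    (h' : ExitCounts x j k l' m') : l = l' ∧ m = m' := by
  obtain ⟨t, ht, hlt, rfl, rfl⟩ := h
  obtain ⟨t', ht', hlt', rfl, rfl⟩ := h'
  rw [eq_of_first_exceed ht hlt ht' hlt']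
  exact ⟨rfl, rfl⟩

theorem tsum_first_exceed {x : ℕ → ℕ} {c T : ℕ} (hT : c < x T) (hlt : ∀ s < T, x s ≤ c)
    (p : ℕ → Prop) [DecidablePred p] (hp : ∀ i, p i → i ≤ c) :
    ∑' t, ((if p (x t) ∧ ∀ s < t, x s ≤ c then 1 else 0 : ℕ) : ℝ≥0∞) =
      (Nat.count (fun s => p (x s)) T : ℝ≥0∞) := by
  rw [tsum_eq_sum (s := Finset.range T), ← Nat.cast_sum, Nat.count_eq_card_filter_range,
    Finset.card_filter]
  · congr 1
    refine Finset.sum_congr rfl fun t ht => ?_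
    have : ∀ s < t, x s ≤ c := fun s hs => hlt s (hs.trans (Finset.mem_range.1 ht))
    exact if_congr (and_iff_left this) rfl rfl
  · intro t ht
    have ht : T ≤ t := by simpa using ht
    rw [if_neg, Nat.cast_zero]
    rintro ⟨h1, h2⟩
    rcases ht.eq_or_lt with rfl | ht
    · exact absurd (hp _ h1) (not_le.2 hT)
    · exact absurd (h2 T ht) (not_le.2 hT)

theorem ExitCounts.fullEstimator_eq {x : ℕ → ℕ} {j k l m : ℕ} (h : ExitCounts x j k l m) :
    fullEstimator x j k = (l : ℝ) / (1 + l + m : ℝ) := by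
  obtain ⟨T, hT, hlt, rfl, rfl⟩ := h
  have hV (p : ℕ) (hp : p ∈ Finset.range (k + 1)) :
      fullV x (j + p) (k - p) = (Nat.count (fun s => x s = j + p) T : ℝ≥0∞) := by
    have hp := Finset.mem_range.1 hp
    rw [fullV_eq_tsum, show j + p + (k - p) = j + k by omega]
    exact tsum_first_exceed hT hlt (fun i => i = j + p) (by omega)
  have hcount (k : ℕ) : ∑ p ∈ Finset.range (k + 1), Nat.count (fun s => x s = j + p) T =
      Nat.count (fun s => x s = j) T + Nat.count (fun s => j < x s ∧ x s ≤ j + k) T := by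
    rw [Finset.sum_congr rfl fun p _ => (Nat.count_eq_card_filter_range _ T).trans
      (Finset.card_filter _ _), Nat.count_eq_card_filter_range, Finset.card_filter,
      Nat.count_eq_card_filter_range, Finset.card_filter]
    rw [Finset.sum_comm, ← Finset.sum_add_distrib]
    refine Finset.sum_congr rfl fun t _ => ?_
    induction k with
    | zero =>
      simp only [zero_add, Finset.sum_range_one, add_zero]
      split_ifs <;> first | rfl | omega
    | succ k ih =>
      rw [Finset.sum_range_succ, ih]
      split_ifs <;> first | rfl | omega
  have hV0 := hV 0 (by simp)
  simp only [add_zero, Nat.sub_zero] at hV0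
  rw [fullEstimator, fullNum, hV0, Finset.sum_congr rfl hV, ← Nat.cast_sum, hcount,
    ENNReal.toReal_div, ENNReal.toReal_natCast, ENNReal.toReal_add (by simp) (by simp)]
  push_cast
  rw [ENNReal.toReal_add (by simp) (by simp)]
  simp [add_assoc]

/-! ### Measurability and independence of events depending on finitely many observations -/

/-- `P` depends on the coordinates before time `t` only. -/
def DependsBefore (P : (ℕ → ℕ) → Prop) (t : ℕ) : Prop :=
  ∀ x y : ℕ → ℕ, (∀ s < t, x s = y s) → (P x ↔ P y)

theorem exists_finset_preimage {Ω : Type*} (X : ℕ → Ω → ℕ) {P : (ℕ → ℕ) → Prop} {t : ℕ}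
    (hP : DependsBefore P t) :
    ∃ A : Set (Finset.range t → ℕ), {ω | P fun i => X i ω} =
      (fun ω (i : Finset.range t) => X i ω) ⁻¹' A := by
  -- A finite tuple is extended by zeros; by `hP` the extension does not affect `P`.
  refine ⟨{y | P fun i => if h : i ∈ Finset.range t then y ⟨i, h⟩ else 0}, ?_⟩
  ext ω
  refine hP _ _ fun s hs => ?_
  simp [hs]

theorem hasSum_measureReal_iUnion {Ω ι : Type*} [MeasurableSpace Ω] [Countable ι] (μ : Measure Ω)
    [IsFiniteMeasure μ] {A : ι → Set Ω} (hA : ∀ i, MeasurableSet (A i))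
    (hd : Pairwise (Function.onFun Disjoint A)) :
    HasSum (fun i => μ.real (A i)) (μ.real (⋃ i, A i)) := by
  have h := measure_iUnion hd hA (μ := μ)
  have hs : ∑' i, μ (A i) ≠ ∞ := h ▸ measure_ne_top μ _
  simp only [Measure.real, h]
  rw [ENNReal.tsum_toReal_eq fun i => measure_ne_top μ _]
  exact ENNReal.hasSum_toReal hs

section IID

variable {Ω : Type*} [MeasurableSpace Ω] {μ : Measure Ω} {X : ℕ → Ω → ℕ}

theorem DependsBefore.measurableSet {P : (ℕ → ℕ) → Prop} {t : ℕ} (hP : DependsBefore P t)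
    (hmeas : ∀ i, Measurable (X i)) : MeasurableSet {ω | P fun i => X i ω} := by
  obtain ⟨A, hA⟩ := exists_finset_preimage X hP
  rw [hA]
  exact measurable_pi_lambda (fun ω (i : Finset.range t) => X i ω) (fun i => hmeas i)
    MeasurableSet.of_discrete

theorem measureReal_inter_of_dependsBefore
    (hmeas : ∀ i, Measurable (X i)) (hindep : iIndepFun X μ)
    (hident : ∀ i, IdentDistrib (X i) (X 0) μ μ) {P : (ℕ → ℕ) → Prop} {t : ℕ}
    (hP : DependsBefore P t) (B : Set ℕ) :
    μ.real {ω | P (fun i => X i ω) ∧ X t ω ∈ B} =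
      μ.real {ω | P fun i => X i ω} * μ.real {ω | X 0 ω ∈ B} := by
  obtain ⟨A, hA⟩ := exists_finset_preimage X hP
  have hI := hindep.indepFun_finset (Finset.range t) {t} (by simp) hmeas
  have h := hI.measure_inter_preimage_eq_mul A {y | y ⟨t, by simp⟩ ∈ B}
    MeasurableSet.of_discrete MeasurableSet.of_discrete
  have h0 : μ {ω | X t ω ∈ B} = μ {ω | X 0 ω ∈ B} :=
    (hident t).measure_mem_eq MeasurableSet.of_discrete
  rw [← hA] at h
  simp only [Measure.real, ← ENNReal.toReal_mul, ← h0]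
  exact congrArg _ h

/-! ### Almost every path is unbounded -/

theorem exists_lt_of_infinite_support {Y : Ω → ℕ} [IsFiniteMeasure μ]
    (hsupp : {i : ℕ | μ.real {ω | Y ω = i} ≠ 0}.Infinite) (c : ℕ) :
    0 < μ.real {ω | c < Y ω} := by
  obtain ⟨i, hi, hci⟩ := hsupp.exists_gt c
  refine (lt_of_le_of_ne measureReal_nonneg (Ne.symm hi)).trans_le (measureReal_mono ?_)
  intro ω hω
  have hω : Y ω = i := hω
  simpa [hω] using hci

/-- By independence, staying at most `c` for `t` steps has probability `r ^ t`, with `r < 1` because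
the support is infinite. -/
theorem ae_exists_lt [IsProbabilityMeasure μ]
    (hmeas : ∀ i, Measurable (X i)) (hindep : iIndepFun X μ)
    (hident : ∀ i, IdentDistrib (X i) (X 0) μ μ)
    (hsupp : {i : ℕ | μ.real {ω | X 0 ω = i} ≠ 0}.Infinite) :
    ∀ᵐ ω ∂μ, ∀ c, ∃ t, c < X t ω := by
  rw [ae_all_iff]
  intro c
  set r := μ.real {ω | X 0 ω ∈ Set.Iic c} with hr
  have hr1 : r < 1 := by
    have h1 := exists_lt_of_infinite_support hsupp c
    have h2 : {ω | X 0 ω ∈ Set.Iic c}ᶜ = {ω | c < X 0 ω} := by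
      ext ω
      simp
    have h3 := probReal_compl_eq_one_sub (μ := μ) (s := {ω | X 0 ω ∈ Set.Iic c})
      (hmeas 0 MeasurableSet.of_discrete)
    rw [h2] at h3
    linarith
  have hpow (t : ℕ) : μ.real {ω | ∀ s < t, X s ω ≤ c} = r ^ t := by
    induction t with
    | zero => simp
    | succ t ih =>
      have hdep : DependsBefore (fun x => ∀ s < t, x s ≤ c) t := fun x y h =>
        forall₂_congr fun s hs => by rw [h s hs]
      rw [pow_succ, ← ih, hr, ← measureReal_inter_of_dependsBefore hmeas hindep hident hdep]
      congr 1
      ext ω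
      exact Nat.forall_lt_succ_right
  rw [ae_iff]
  have hle (t : ℕ) : μ.real {ω | ¬∃ t, c < X t ω} ≤ r ^ t := by
    rw [← hpow t]
    exact measureReal_mono fun ω hω s _ => by
      have := not_exists.1 hω s
      omega
  have h0 : μ.real {ω | ¬∃ t, c < X t ω} ≤ 0 :=
    ge_of_tendsto' (tendsto_pow_atTop_nhds_zero_of_lt_one measureReal_nonneg hr1) hle
  exact (measureReal_eq_zero_iff (measure_ne_top μ _)).1 (le_antisymm h0 measureReal_nonneg)

/-! ### The joint law of the exit counts -/

/-- The path stays at most `j + k` before time `t`, and takes there `l` times the value `j` and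
`m` times a value in `(j, j + k]`. -/
def CountsBefore (j k t : ℕ) (l m : ℤ) (x : ℕ → ℕ) : Prop :=
  (∀ s < t, x s ≤ j + k) ∧ (Nat.count (fun s => x s = j) t : ℤ) = l ∧
    (Nat.count (fun s => j < x s ∧ x s ≤ j + k) t : ℤ) = m

theorem count_congr_before {p q : ℕ → Prop} [DecidablePred p] [DecidablePred q] {t : ℕ}
    (h : ∀ s < t, (p s ↔ q s)) : Nat.count p t = Nat.count q t := by
  rw [Nat.count_eq_card_filter_range, Nat.count_eq_card_filter_range]
  exact congrArg _ (Finset.filter_congr fun s hs => h s (Finset.mem_range.1 hs))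

theorem dependsBefore_countsBefore (j k t : ℕ) (l m : ℤ) :
    DependsBefore (CountsBefore j k t l m) t := by
  intro x y h
  have h1 : (∀ s < t, x s ≤ j + k) ↔ ∀ s < t, y s ≤ j + k :=
    forall₂_congr fun s hs => by rw [h s hs]
  have h2 : Nat.count (fun s => x s = j) t = Nat.count (fun s => y s = j) t :=
    count_congr_before fun s hs => by rw [h s hs]
  have h3 : Nat.count (fun s => j < x s ∧ x s ≤ j + k) t =
      Nat.count (fun s => j < y s ∧ y s ≤ j + k) t :=
    count_congr_before fun s hs => by rw [h s hs]
  simp only [CountsBefore, h1, h2, h3]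

theorem exitCounts_iff {x : ℕ → ℕ} {j k l m : ℕ} :
    ExitCounts x j k l m ↔ ∃ t, CountsBefore j k t l m x ∧ x t ∈ Set.Ioi (j + k) := by
  simp only [ExitCounts, CountsBefore, Nat.cast_inj, Set.mem_Ioi]
  exact exists_congr fun t => by tauto

/-- The last observation is below `j`, equal to `j`, or in `(j, j + k]`. Integer counts keep this
valid at `l = 0` and `m = 0`, where the shifted events are empty. -/
theorem countsBefore_succ_iff {x : ℕ → ℕ} {j k t : ℕ} {l m : ℤ} :
    CountsBefore j k (t + 1) l m x ↔
      (CountsBefore j k t l m x ∧ x t ∈ Set.Iio j) ∨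
      (CountsBefore j k t (l - 1) m x ∧ x t ∈ ({j} : Set ℕ)) ∨
      (CountsBefore j k t l (m - 1) x ∧ x t ∈ Set.Ioc j (j + k)) := by
  simp only [CountsBefore, Nat.count_succ, Nat.forall_lt_succ_right, Set.mem_Iio,
    Set.mem_singleton_iff, Set.mem_Ioc]
  by_cases h : ∀ s < t, x s ≤ j + k
  · rw [and_iff_right h, and_iff_right h, and_iff_right h, and_assoc, and_iff_right h]
    split_ifs <;> push_cast <;> omega
  · simp [h]

theorem measurableSet_countsBefore_inter (hmeas : ∀ i, Measurable (X i)) (j k t : ℕ) (l m : ℤ)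
    (B : Set ℕ) : MeasurableSet {ω | CountsBefore j k t l m (fun i => X i ω) ∧ X t ω ∈ B} :=
  ((dependsBefore_countsBefore j k t l m).measurableSet hmeas).inter
    (hmeas t MeasurableSet.of_discrete)

theorem measurableSet_exitCounts (hmeas : ∀ i, Measurable (X i)) (j k l m : ℕ) :
    MeasurableSet {ω | ExitCounts (fun i => X i ω) j k l m} := by
  simp only [exitCounts_iff, Set.ofPred_exists]
  exact MeasurableSet.iUnion fun t => measurableSet_countsBefore_inter hmeas j k t l m _

theorem measureReal_countsBefore_zero [IsProbabilityMeasure μ] (j k : ℕ) (l m : ℤ) :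
    μ.real {ω | CountsBefore j k 0 l m fun i => X i ω} = if l = 0 ∧ m = 0 then 1 else 0 := by
  split_ifs with h
  · simp [CountsBefore, h.1, h.2]
  · have : {ω | CountsBefore j k 0 l m fun i => X i ω} = ∅ := by
      ext ω
      simp only [CountsBefore, Nat.count_zero, Set.mem_ofPred_eq, Set.mem_empty_iff_false,
        iff_false]
      rintro ⟨-, rfl, rfl⟩
      simp at h
    rw [this, measureReal_empty]

theorem measureReal_countsBefore_succ [IsProbabilityMeasure μ]
    (hmeas : ∀ i, Measurable (X i)) (hindep : iIndepFun X μ)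
    (hident : ∀ i, IdentDistrib (X i) (X 0) μ μ) (j k t : ℕ) (l m : ℤ) :
    μ.real {ω | CountsBefore j k (t + 1) l m fun i => X i ω} =
      μ.real {ω | CountsBefore j k t l m fun i => X i ω} * μ.real {ω | X 0 ω ∈ Set.Iio j} +
      (μ.real {ω | CountsBefore j k t (l - 1) m fun i => X i ω} *
          μ.real {ω | X 0 ω ∈ ({j} : Set ℕ)} +
        μ.real {ω | CountsBefore j k t l (m - 1) fun i => X i ω} *
          μ.real {ω | X 0 ω ∈ Set.Ioc j (j + k)}) := by
  have hdep := dependsBefore_countsBefore j k t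
  rw [← measureReal_inter_of_dependsBefore hmeas hindep hident (hdep _ _),
    ← measureReal_inter_of_dependsBefore hmeas hindep hident (hdep _ _),
    ← measureReal_inter_of_dependsBefore hmeas hindep hident (hdep _ _),
    ← measureReal_union _ (measurableSet_countsBefore_inter hmeas _ _ _ _ _ _),
    ← measureReal_union _ ((measurableSet_countsBefore_inter hmeas _ _ _ _ _ _).union
      (measurableSet_countsBefore_inter hmeas _ _ _ _ _ _))]
  · congr 1
    ext ω
    exact countsBefore_succ_iff
  · rw [Set.disjoint_left]
    rintro ω ⟨-, h1⟩ (⟨-, h2⟩ | ⟨-, h2⟩)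
    · simp only [Set.mem_Iio, Set.mem_singleton_iff] at h1 h2
      omega
    · simp only [Set.mem_Iio, Set.mem_Ioc] at h1 h2
      omega
  · rw [Set.disjoint_left]
    rintro ω ⟨-, h1⟩ ⟨-, h2⟩
    simp only [Set.mem_singleton_iff, Set.mem_Ioc] at h1 h2
    omega

theorem hasSum_countsBefore_mul [IsProbabilityMeasure μ]
    (hmeas : ∀ i, Measurable (X i)) (hindep : iIndepFun X μ)
    (hident : ∀ i, IdentDistrib (X i) (X 0) μ μ) (j k : ℕ) (l m : ℤ) :
    HasSum (fun t => μ.real {ω | CountsBefore j k t l m fun i => X i ω} *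
        μ.real {ω | X 0 ω ∈ Set.Ioi (j + k)})
      (μ.real (⋃ t, {ω | CountsBefore j k t l m (fun i => X i ω) ∧
        X t ω ∈ Set.Ioi (j + k)})) := by
  simp only [← measureReal_inter_of_dependsBefore hmeas hindep hident
    (dependsBefore_countsBefore j k _ l m)]
  refine hasSum_measureReal_iUnion μ
    (fun t => measurableSet_countsBefore_inter hmeas j k t l m _) fun t t' hne => ?_
  rw [Function.onFun, Set.disjoint_left]
  rintro ω ⟨h1, h2⟩ ⟨h3, h4⟩
  exact hne (eq_of_first_exceed h2 h1.1 h4 h3.1)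

/-- The recursion solved by the joint law of the exit counts. -/
theorem eq_choose_mul_of_recursion {F : ℤ → ℤ → ℝ} {h w e : ℝ}
    (h1 : ∀ m, F (-1) m = 0) (h2 : ∀ l, F l (-1) = 0)
    (hF : ∀ l m, F l m = (if l = 0 ∧ m = 0 then e else 0) + h * F (l - 1) m + w * F l (m - 1))
    (l m : ℕ) : F l m = ((m + l).choose l : ℝ) * h ^ l * w ^ m * e := by
  induction l generalizing m with
  | zero =>
    induction m with
    | zero => rw [hF]; simp [h1, h2]
    | succ m ih =>
      rw [hF]
      have : ((m + 1 : ℕ) : ℤ) - 1 = m := by push_cast; ring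
      rw [this, ih, if_neg (by push_cast; omega)]
      simp [h1]
      ring
  | succ l ihl =>
    have hl : ((l + 1 : ℕ) : ℤ) - 1 = l := by push_cast; ring
    induction m with
    | zero =>
      rw [hF, hl, ihl, if_neg (by push_cast; omega)]
      simp [h2]
      ring
    | succ m ihm =>
      have hm : ((m + 1 : ℕ) : ℤ) - 1 = m := by push_cast; ring
      rw [hF, hl, hm, ihl, ihm, if_neg (by push_cast; omega),
        -- Pascal's rule combines the two predecessors.
        show m + 1 + (l + 1) = (m + l + 1) + 1 by ring, Nat.choose_succ_succ,
        show m + 1 + l = m + l + 1 by ring, show m + (l + 1) = m + l + 1 by ring]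
      push_cast
      ring

/-! ### Interval probabilities and hazard rates. -/

theorem measureReal_Iio_eq [IsProbabilityMeasure μ] {Y : Ω → ℕ} (hY : Measurable Y) (j : ℕ) :
    μ.real {ω | Y ω ∈ Set.Iio j} = 1 - μ.real {ω | j ≤ Y ω} := by
  have hm : MeasurableSet {ω | j ≤ Y ω} := hY (MeasurableSet.of_discrete (s := Set.Ici j))
  rw [← probReal_compl_eq_one_sub hm]
  congr 1
  ext ω
  simp

theorem measureReal_Ioc_eq [IsProbabilityMeasure μ] {Y : Ω → ℕ} (hY : Measurable Y) (j k : ℕ) :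
    μ.real {ω | Y ω ∈ Set.Ioc j (j + k)} = ∑ i ∈ Finset.Icc 1 k, μ.real {ω | Y ω = j + i} := by
  rw [← measureReal_biUnion_finset]
  · congr 1
    ext ω
    simp only [Set.mem_Ioc, Set.mem_ofPred_eq, Set.mem_iUnion, Finset.mem_Icc, exists_prop]
    exact ⟨fun h => ⟨Y ω - j, by omega⟩, fun ⟨i, hi⟩ => by omega⟩
  · intro i _ i' _ hne
    rw [Function.onFun, Set.disjoint_left]
    intro ω h1 h2
    simp only [Set.mem_ofPred_eq] at h1 h2
    omega
  · exact fun i _ => hY (MeasurableSet.of_discrete (s := {j + i}))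

theorem measureReal_Ici_eq [IsProbabilityMeasure μ] {Y : Ω → ℕ} (hY : Measurable Y) (j k : ℕ) :
    μ.real {ω | j ≤ Y ω} = μ.real {ω | Y ω = j} + μ.real {ω | Y ω ∈ Set.Ioc j (j + k)} +
      μ.real {ω | Y ω ∈ Set.Ioi (j + k)} := by
  rw [← measureReal_union, ← measureReal_union]
  · congr 1
    ext ω
    simp only [Set.mem_Ioc, Set.mem_ofPred_eq, Set.mem_union, Set.mem_Ioi]
    omega
  · rw [Set.disjoint_left]
    intro ω h1 h2
    simp only [Set.mem_Ioc, Set.mem_ofPred_eq, Set.mem_union, Set.mem_Ioi] at h1 h2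
    omega
  · exact hY MeasurableSet.of_discrete
  · rw [Set.disjoint_left]
    intro ω h1 h2
    simp only [Set.mem_Ioc, Set.mem_ofPred_eq] at h1 h2
    omega
  · exact hY MeasurableSet.of_discrete

theorem one_sub_dParam [IsProbabilityMeasure μ] {Y : Ω → ℕ} (hY : Measurable Y) (j k : ℕ) :
    1 - dParam μ Y j k = μ.real {ω | Y ω ∈ Set.Ioc j (j + k)} / μ.real {ω | j ≤ Y ω} := by
  simp only [dParam, condHazard, sub_sub_cancel, measureReal_Ioc_eq hY, Finset.sum_div]

theorem measureReal_Ici_pos [IsProbabilityMeasure μ] {Y : Ω → ℕ}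
    (hsupp : {i : ℕ | μ.real {ω | Y ω = i} ≠ 0}.Infinite) (j : ℕ) :
    0 < μ.real {ω | j ≤ Y ω} :=
  (exists_lt_of_infinite_support hsupp j).trans_le
    (measureReal_mono fun _ h => le_of_lt (Set.mem_ofPred.1 h))

theorem dParam_sub_hazard [IsProbabilityMeasure μ] {Y : Ω → ℕ} (hY : Measurable Y)
    (hsupp : {i : ℕ | μ.real {ω | Y ω = i} ≠ 0}.Infinite) (j k : ℕ) :
    dParam μ Y j k - hazard μ Y j =
      μ.real {ω | Y ω ∈ Set.Ioi (j + k)} / μ.real {ω | j ≤ Y ω} := by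
  have hs := measureReal_Ici_pos hsupp j
  have h1 := one_sub_dParam (μ := μ) hY j k
  have h2 := measureReal_Ici_eq (μ := μ) hY j k
  have h3 : dParam μ Y j k =
    1 - μ.real {ω | Y ω ∈ Set.Ioc j (j + k)} / μ.real {ω | j ≤ Y ω} := by linarith
  rw [h3, hazard, condHazard]
  field_simp
  linarith

theorem dParam_sub_hazard_pos [IsProbabilityMeasure μ] {Y : Ω → ℕ} (hY : Measurable Y)
    (hsupp : {i : ℕ | μ.real {ω | Y ω = i} ≠ 0}.Infinite) (j k : ℕ) :
    0 < dParam μ Y j k - hazard μ Y j := by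
  rw [dParam_sub_hazard hY hsupp]
  exact div_pos (exists_lt_of_infinite_support hsupp (j + k)) (measureReal_Ici_pos hsupp j)

/-- Summing the one-step decomposition over all exit times yields a recursion in `(l, m)`. The term
for a value below `j` reproduces the same unknown; moving it to the left leaves the factor `P(X ≥
j)`, and dividing by it produces the hazard rates. -/
theorem measureReal_exitCounts [IsProbabilityMeasure μ]
    (hmeas : ∀ i, Measurable (X i)) (hindep : iIndepFun X μ)
    (hident : ∀ i, IdentDistrib (X i) (X 0) μ μ)
    (hsupp : {i : ℕ | μ.real {ω | X 0 ω = i} ≠ 0}.Infinite) (j k l m : ℕ) :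
    μ.real {ω | ExitCounts (fun i => X i ω) j k l m} =
      ((m + l).choose l : ℝ) * hazard μ (X 0) j ^ l * (1 - dParam μ (X 0) j k) ^ m *
        (dParam μ (X 0) j k - hazard μ (X 0) j) := by
  have hs := measureReal_Ici_pos hsupp j
  have hp : 0 < μ.real {ω | X 0 ω ∈ Set.Ioi (j + k)} := exists_lt_of_infinite_support hsupp (j + k)
  set F : ℤ → ℤ → ℝ := fun l m => μ.real (⋃ t, {ω | CountsBefore j k t l m (fun i => X i ω) ∧
        X t ω ∈ Set.Ioi (j + k)}) with hF
  have hsum (l m : ℤ) := hasSum_countsBefore_mul hmeas hindep hident j k l m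
  have hG : μ.real {ω | ExitCounts (fun i => X i ω) j k l m} = F l m := by
    simp only [exitCounts_iff, Set.ofPred_exists, hF]
  rw [hG]
  refine eq_choose_mul_of_recursion ?_ ?_ ?_ l m
  · intro m
    have h0 (t : ℕ) : {ω | CountsBefore j k t (-1) m (fun i => X i ω) ∧
        X t ω ∈ Set.Ioi (j + k)} = ∅ :=
      Set.eq_empty_of_forall_notMem fun ω hω => by
        have := hω.1.2.1
        omega
    simp only [hF, h0, Set.iUnion_empty, measureReal_empty]
  · intro l
    have h0 (t : ℕ) : {ω | CountsBefore j k t l (-1) (fun i => X i ω) ∧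
        X t ω ∈ Set.Ioi (j + k)} = ∅ :=
      Set.eq_empty_of_forall_notMem fun ω hω => by
        have := hω.1.2.2
        omega
    simp only [hF, h0, Set.iUnion_empty, measureReal_empty]
  · intro l m
    have hstep := ((hsum l m).mul_right (μ.real {ω | X 0 ω ∈ Set.Iio j})).add
      (((hsum (l - 1) m).mul_right (μ.real {ω | X 0 ω ∈ ({j} : Set ℕ)})).add
        ((hsum l (m - 1)).mul_right (μ.real {ω | X 0 ω ∈ Set.Ioc j (j + k)})))
    -- Splitting off `t = 0` isolates the source term, an exit at the very first observation.
    have hshift := (hasSum_nat_add_iff' 1).2 (hsum l m)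
    simp only [measureReal_countsBefore_succ hmeas hindep hident, Finset.sum_range_one,
      measureReal_countsBefore_zero] at hshift
    have heq := hshift.unique (hstep.congr_fun fun t => by ring)
    rw [one_sub_dParam (hmeas 0), dParam_sub_hazard (hmeas 0) hsupp, hazard, condHazard]
    rw [measureReal_Iio_eq (hmeas 0)] at heq
    simp only [Set.mem_singleton_iff] at heq
    change F l m - _ = F l m * _ + (F (l - 1) m * _ + F l (m - 1) * _) at heq
    split_ifs at heq ⊢ <;> field_simp <;> linarith

end IID

/-! ### The law of the estimator -/

theorem summable_and_eq_mul_tsum {ι : Type*} {f : ι → ℝ} {c A : ℝ} (hc : c ≠ 0)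
    (h : HasSum (fun i => f i * c) A) : Summable f ∧ A = c * ∑' i, f i := by
  refine ⟨(summable_mul_right_iff hc).1 h.summable, ?_⟩
  rw [← h.tsum_eq, tsum_mul_right, mul_comm]

/-- Since `a / b` is in lowest terms, `(l, 1 + l + m)` is a multiple `c (a, b)`; here `c ≥ 1`
because `1 + l + m > 0`, whence the index `c = i + 1`. -/
theorem div_eq_div_iff_exists {a b : ℕ} (hab : a < b) (hcop : Nat.Coprime a b) (l m : ℕ) :
    (l : ℝ) / (1 + l + m) = (a : ℝ) / b ↔
      ∃ i : ℕ, (a * (i + 1), (b - a) * (i + 1) - 1) = (l, m) := by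
  have hb : (b : ℝ) ≠ 0 := by
    have : b ≠ 0 := by omega
    exact_mod_cast this
  obtain ⟨e, rfl⟩ := Nat.exists_eq_add_of_lt hab
  rw [div_eq_div_iff (by positivity) hb]
  simp only [Prod.mk.injEq, show a + e + 1 - a = e + 1 by omega]
  constructor
  · intro h
    have h : l * (a + e + 1) = a * (1 + l + m) := by exact_mod_cast h
    obtain ⟨c, hc⟩ : (a + e + 1) ∣ 1 + l + m :=
      hcop.symm.dvd_of_dvd_mul_left ⟨l, by rw [← h, mul_comm]⟩
    have hl : l = a * c := by
      rw [hc] at h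
      exact Nat.eq_of_mul_eq_mul_right (show 0 < a + e + 1 by omega) (by rw [h]; ring)
    obtain ⟨i, rfl⟩ : ∃ i, c = i + 1 := Nat.exists_eq_add_one_of_ne_zero (by
      rintro rfl
      omega)
    refine ⟨i, hl.symm, ?_⟩
    have : (a + e + 1) * (i + 1) = a * (i + 1) + (e + 1) * (i + 1) := by ring
    omega
  · rintro ⟨i, rfl, rfl⟩
    have h1 : 1 ≤ (e + 1) * (i + 1) := Nat.mul_pos (Nat.succ_pos e) (Nat.succ_pos i)
    push_cast [Nat.cast_sub h1]
    ring

theorem div_le_iff_le_floor {x : ℝ} (h0 : 0 ≤ x) (h1 : x < 1) (l m : ℕ) :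
    (l : ℝ) / (1 + l + m) ≤ x ↔ l ≤ ⌊(1 + (m : ℝ)) * x / (1 - x)⌋₊ := by
  have hx : 0 < 1 - x := sub_pos.2 h1
  rw [Nat.le_floor_iff (by positivity), div_le_iff₀ (by positivity), le_div_iff₀ hx]
  constructor <;> intro h <;> linarith

section Law

variable {Ω : Type*} [MeasurableSpace Ω] {μ : Measure Ω} [IsProbabilityMeasure μ] {X : ℕ → Ω → ℕ}

/-- Almost surely exactly one pair `(l, m)` of exit counts occurs, so the event is a disjoint union
over any injective enumeration `c` of the pairs satisfying `p`. -/
theorem hasSum_measureReal_fullEstimator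
    (hmeas : ∀ i, Measurable (X i)) (hindep : iIndepFun X μ)
    (hident : ∀ i, IdentDistrib (X i) (X 0) μ μ)
    (hsupp : {i : ℕ | μ.real {ω | X 0 ω = i} ≠ 0}.Infinite) (j k : ℕ)
    {ι : Type*} [Countable ι] {c : ι → ℕ × ℕ} (hc : Function.Injective c) {p : ℝ → Prop}
    (hp : ∀ l m : ℕ, p ((l : ℝ) / (1 + l + m)) ↔ ∃ i, c i = (l, m)) :
    HasSum (fun i => (((c i).2 + (c i).1).choose (c i).1 : ℝ) * hazard μ (X 0) j ^ (c i).1 *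
        (1 - dParam μ (X 0) j k) ^ (c i).2 * (dParam μ (X 0) j k - hazard μ (X 0) j))
      (μ.real {ω | p (fullEstimator (fun i => X i ω) j k)}) := by
  simp only [← measureReal_exitCounts hmeas hindep hident hsupp j k]
  have hae : {ω | p (fullEstimator (fun i => X i ω) j k)} =ᵐ[μ]
      ⋃ i, {ω | ExitCounts (fun i => X i ω) j k (c i).1 (c i).2} := by
    filter_upwards [ae_exists_lt hmeas hindep hident hsupp] with ω hω
    apply propext
    obtain ⟨l, m, hlm⟩ := exists_exitCounts hω j k
    change p (fullEstimator (fun i => X i ω) j k) ↔ ω ∈ ⋃ i, _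
    rw [hlm.fullEstimator_eq, hp, Set.mem_iUnion]
    constructor
    · rintro ⟨i, hi⟩
      refine ⟨i, ?_⟩
      rw [hi]
      exact hlm
    · rintro ⟨i, hi⟩
      obtain ⟨h1, h2⟩ := hlm.unique hi
      exact ⟨i, Prod.ext h1.symm h2.symm⟩
  rw [measureReal_congr hae]
  refine hasSum_measureReal_iUnion μ (fun i => measurableSet_exitCounts hmeas _ _ _ _)
    fun i i' hne => ?_
  rw [Function.onFun, Set.disjoint_left]
  intro ω h1 h2
  obtain ⟨h3, h4⟩ := ExitCounts.unique h1 h2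
  exact hne (hc (Prod.ext h3 h4))

theorem measureReal_fullEstimator_eq
    (hmeas : ∀ i, Measurable (X i)) (hindep : iIndepFun X μ)
    (hident : ∀ i, IdentDistrib (X i) (X 0) μ μ)
    (hsupp : {i : ℕ | μ.real {ω | X 0 ω = i} ≠ 0}.Infinite) (j k : ℕ) {h d : ℝ}
    (hh : h = hazard μ (X 0) j) (hd : d = dParam μ (X 0) j k)
    {a b : ℕ} (hab : a < b) (hcop : Nat.Coprime a b) :
    Summable (fun i : ℕ => ((b * (i + 1) - 1).choose (a * (i + 1)) : ℝ) *
      h ^ (a * (i + 1)) * (1 - d) ^ ((b - a) * (i + 1) - 1)) ∧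
    μ.real {ω | fullEstimator (fun i => X i ω) j k = (a : ℝ) / (b : ℝ)} =
      (d - h) * ∑' i : ℕ, ((b * (i + 1) - 1).choose (a * (i + 1)) : ℝ) *
        h ^ (a * (i + 1)) * (1 - d) ^ ((b - a) * (i + 1) - 1) := by
  have hadd (i : ℕ) : (b - a) * (i + 1) - 1 + a * (i + 1) = b * (i + 1) - 1 := by
    have h1 : 1 ≤ (b - a) * (i + 1) := Nat.mul_pos (Nat.sub_pos_of_lt hab) (Nat.succ_pos i)
    rw [← Nat.sub_add_comm h1, ← add_mul, Nat.sub_add_cancel hab.le]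
  -- For `a = 0` the first coordinate is constant, so injectivity is read off the sum of the
  -- coordinates, `b * (i + 1) - 1`.
  have hinj : Function.Injective fun i : ℕ => (a * (i + 1), (b - a) * (i + 1) - 1) := by
    intro i i' hi
    have h1 := hadd i
    have h2 := hadd i'
    simp only [Prod.mk.injEq] at hi
    rw [hi.1, hi.2, h2] at h1
    have hb : 0 < b := by omega
    have h3 := Nat.mul_pos hb (Nat.succ_pos i)
    have h4 := Nat.mul_pos hb (Nat.succ_pos i')
    have h5 : b * (i + 1) = b * (i' + 1) := by
      simp only [Nat.succ_eq_add_one] at h3 h4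
      omega
    exact Nat.succ_injective (Nat.eq_of_mul_eq_mul_left hb h5)
  have hpos := dParam_sub_hazard_pos (hmeas 0) hsupp j k
  have hsum := hasSum_measureReal_fullEstimator hmeas hindep hident hsupp j k hinj
    (p := fun y => y = (a : ℝ) / b) (div_eq_div_iff_exists hab hcop)
  subst hh hd
  simp only [hadd] at hsum
  exact summable_and_eq_mul_tsum hpos.ne' hsum

theorem measureReal_fullEstimator_le
    (hmeas : ∀ i, Measurable (X i)) (hindep : iIndepFun X μ)
    (hident : ∀ i, IdentDistrib (X i) (X 0) μ μ)
    (hsupp : {i : ℕ | μ.real {ω | X 0 ω = i} ≠ 0}.Infinite) (j k : ℕ) {h d : ℝ}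
    (hh : h = hazard μ (X 0) j) (hd : d = dParam μ (X 0) j k)
    {x : ℝ} (h0 : 0 ≤ x) (h1 : x < 1) :
    Summable (fun m : ℕ => (1 - d) ^ m *
      ∑ l ∈ Finset.range (⌊(1 + (m : ℝ)) * x / (1 - x)⌋₊ + 1),
        ((m + l).choose l : ℝ) * h ^ l) ∧
    μ.real {ω | fullEstimator (fun i => X i ω) j k ≤ x} =
      (d - h) * ∑' m : ℕ, (1 - d) ^ m *
        ∑ l ∈ Finset.range (⌊(1 + (m : ℝ)) * x / (1 - x)⌋₊ + 1),
          ((m + l).choose l : ℝ) * h ^ l := by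
  let c : (Σ m : ℕ, Fin (⌊(1 + (m : ℝ)) * x / (1 - x)⌋₊ + 1)) → ℕ × ℕ := fun i => (i.2, i.1)
  have hinj : Function.Injective c := by
    rintro ⟨m, l⟩ ⟨m', l'⟩ hi
    simp only [c, Prod.mk.injEq] at hi
    obtain ⟨h2, rfl⟩ := hi
    rw [Fin.ext h2]
  have hpos := dParam_sub_hazard_pos (hmeas 0) hsupp j k
  have hsum := hasSum_measureReal_fullEstimator hmeas hindep hident hsupp j k hinj
    (p := fun y => y ≤ x) fun l m => by
      rw [div_le_iff_le_floor h0 h1]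
      constructor
      · exact fun hl => ⟨⟨m, ⟨l, Nat.lt_succ_iff.2 hl⟩⟩, rfl⟩
      · rintro ⟨⟨m', l'⟩, hi⟩
        simp only [c, Prod.mk.injEq] at hi
        obtain ⟨rfl, rfl⟩ := hi
        exact Nat.lt_succ_iff.1 l'.2
  subst hh hd
  refine summable_and_eq_mul_tsum hpos.ne' ?_
  -- The family over pairs is summed first over the finite fibre of each `m`.
  convert hsum.sigma fun m => hasSum_fintype _ using 2 with m
  rw [Finset.sum_range, Finset.mul_sum, Finset.sum_mul]
  refine Finset.sum_congr rfl fun l _ => ?_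
  simp only [c]
  ring

end Law

end DeltaRecord

/-! ### Transfer to the record-based estimator. -/

theorem mainTheorem1 {Ω : Type*} [MeasurableSpace Ω] (μ : Measure Ω) [IsProbabilityMeasure μ]
    (X : ℕ → Ω → ℕ) (hmeas : ∀ i, Measurable (X i)) (hindep : iIndepFun X μ)
    (hident : ∀ i, IdentDistrib (X i) (X 0) μ μ)
    (hsupp : {i : ℕ | μ.real {ω | X 0 ω = i} ≠ 0}.Infinite)
    (j k : ℕ) (hk : 1 ≤ k) (h d : ℝ)
    (hh : h = DeltaRecord.hazard μ (X 0) j) (hd : d = DeltaRecord.dParam μ (X 0) j k) :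
    -- when the `n`-th record is at least `j + k`, the estimator computed from the sample of the
    -- first `n` records is the one computed from the entire sequence
    (∀ n : ℕ, 1 ≤ n → ∀ᵐ ω ∂μ,
      j + k ≤ DeltaRecord.recordValue (fun i => X i ω) (n - 1) →
        (DeltaRecord.sampleOf (fun i => X i ω) k n).estimator j k =
          DeltaRecord.fullEstimator (fun i => X i ω) j k) ∧
    -- the law of the estimator, whether computed from the entire sequence or from the sample of
    -- the first `ν` records, where `ν` is deterministic or random and `R_ν ≥ j + k` almost surely
    (∀ hHat : Ω → ℝ,
      ((hHat = fun ω => DeltaRecord.fullEstimator (fun i => X i ω) j k) ∨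
        ∃ ν : Ω → ℕ,
          (∀ᵐ ω ∂μ, 1 ≤ ν ω ∧
            j + k ≤ DeltaRecord.recordValue (fun i => X i ω) (ν ω - 1)) ∧
          hHat = fun ω => (DeltaRecord.sampleOf (fun i => X i ω) k (ν ω)).estimator j k) →
      (∀ ω, ∃ q : ℚ, 0 ≤ q ∧ q < 1 ∧ hHat ω = (q : ℝ)) ∧
      (∀ a b : ℕ, a < b → Nat.Coprime a b →
        Summable (fun i : ℕ => ((b * (i + 1) - 1).choose (a * (i + 1)) : ℝ) *
          h ^ (a * (i + 1)) * (1 - d) ^ ((b - a) * (i + 1) - 1)) ∧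
        μ.real {ω | hHat ω = (a : ℝ) / (b : ℝ)} =
          (d - h) * ∑' i : ℕ, ((b * (i + 1) - 1).choose (a * (i + 1)) : ℝ) *
            h ^ (a * (i + 1)) * (1 - d) ^ ((b - a) * (i + 1) - 1)) ∧
      (∀ x : ℝ, 0 ≤ x → x < 1 →
        Summable (fun m : ℕ => (1 - d) ^ m *
          ∑ l ∈ Finset.range (⌊(1 + (m : ℝ)) * x / (1 - x)⌋₊ + 1),
            ((m + l).choose l : ℝ) * h ^ l) ∧
        μ.real {ω | hHat ω ≤ x} =
          (d - h) * ∑' m : ℕ, (1 - d) ^ m *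
            ∑ l ∈ Finset.range (⌊(1 + (m : ℝ)) * x / (1 - x)⌋₊ + 1),
              ((m + l).choose l : ℝ) * h ^ l)) := by
  have hae := DeltaRecord.ae_exists_lt hmeas hindep hident hsupp
  refine ⟨fun n hn => ?_, fun hHat hcase => ?_⟩
  · filter_upwards [hae] with ω hω hR
    exact DeltaRecord.sample_estimator_eq_fullEstimator hω hn hR
  have hcongr : ∀ᵐ ω ∂μ, hHat ω = DeltaRecord.fullEstimator (fun i => X i ω) j k := by
    rcases hcase with rfl | ⟨ν, hν, rfl⟩
    · exact Filter.Eventually.of_forall fun _ => rfl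
    · filter_upwards [hae, hν] with ω hω hR
      exact DeltaRecord.sample_estimator_eq_fullEstimator hω hR.1 hR.2
  have hlaw (p : ℝ → Prop) : μ.real {ω | p (hHat ω)} =
      μ.real {ω | p (DeltaRecord.fullEstimator (fun i => X i ω) j k)} :=
    measureReal_congr <| by
      filter_upwards [hcongr] with ω hω
      change p (hHat ω) = p _
      rw [hω]
  refine ⟨fun ω => ?_, fun a b hab hcop => ?_, fun x h0 h1 => ?_⟩
  -- Rationality is claimed for every `ω`, so the almost sure equality does not suffice and each
  -- estimator is treated directly.
  · rcases hcase with rfl | ⟨ν, -, rfl⟩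
    · exact DeltaRecord.exists_rat_fullEstimator _ j k
    · exact DeltaRecord.Sample.exists_rat_estimator _ j k
  · rw [hlaw fun y => y = (a : ℝ) / (b : ℝ)]
    exact DeltaRecord.measureReal_fullEstimator_eq hmeas hindep hident hsupp j k hh hd hab hcop
  · rw [hlaw fun y => y ≤ x]
    exact DeltaRecord.measureReal_fullEstimator_le hmeas hindep hident hsupp j k hh hd h0 h1
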